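/- Let $\langle x,y\rangle=\sum_{k=1}^n\bar x_k y_k$ denote the standard inner product on $\mathbb{C}^n$, $e_1,\dots,e_n$ the standard basis, $\|z\|_{\ell_2}$ the Euclidean norm, $\|z\|_{\ell_1}=\sum_k|z_k|$, and $\|z\|_0$ the number of nonzero entries of $z$. For $s\in\mathbb{N}$ let $\sigma_s(x)=\inf_{\|z\|_0\le s}\|x-z\|_{\ell_1}$ and $$T_s=\{z\in\mathbb{C}^n:\ \|z\|_{\ell_2}=1,\ \|z\|_{\ell_1}\ge 2\sigma_s(z)\}.$$ A matrix $A\in\mathbb{C}^{m\times n}$ satisfies the complex null space property of order $s$ if $\inf_{z\in T_s}\|Az\|_{\ell_2}>0$ (with $\inf\emptyset=\infty$). **Theorem 5.** For every $C_4>0$ there are constants $C,\tilde c>0$, depending only on $C_4$, such that the following holds for all $n,s,m\in\mathbb{N}$ with $m\ge C\,s\log n$. Let $a\in\mathbb{C}^n$ be a random vector such that - (isotropy) $\mathbb{E}|\langle a,z\rangle|^2=\|z\|_{\ell_2}^2$ for all $z\in\mathbb{C}^n$; - (incoherence) $\max_{1\le k\le n}|\langle e_k,a\rangle|^2=1$ almost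 surely; - (4th moment bound) $\mathbb{E}|\langle a,z\rangle|^4\le C_4\|z\|_{\ell_2}^4$ for all $z\in\mathbb{C}^n$. Let $A$ be the random $m\times n$ matrix whose rows are $m$ independent copies of $a$. Then $A$ satisfies the complex null space property of order $s$ with probability at least $1-2e^{-\tilde c m}$. -/

import Mathlib

open MeasureTheory ProbabilityTheory

noncomputable section

namespace CompressedSensing

/-- The `ℓ₁`-norm `∑ k, |z k|` of a vector in `ℂⁿ`. -/
def l1Norm {n : ℕ} (z : EuclideanSpace ℂ (Fin n)) : ℝ :=
  ∑ k, ‖z k‖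

/-- The number of nonzero entries of a vector in `ℂⁿ`. -/
def zeroNorm {n : ℕ} (z : EuclideanSpace ℂ (Fin n)) : ℕ :=
  hammingNorm (fun k => z k)

/-- The error, in `ℓ₁`-norm, of the best `s`-sparse approximation. The infimum is over a nonempty
set (it contains `z = 0`) of nonnegative reals. -/
def sparseError {n : ℕ} (s : ℕ) (x : EuclideanSpace ℂ (Fin n)) : ℝ :=
  ⨅ z : {z : EuclideanSpace ℂ (Fin n) // zeroNorm z ≤ s}, l1Norm (x - z.1)

/-- The unit vectors `z` of `ℂⁿ` with `‖z‖₁ ≥ 2 σ_s(z)`. -/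
def nspSet (n s : ℕ) : Set (EuclideanSpace ℂ (Fin n)) :=
  {z | z ∈ Metric.sphere (0 : EuclideanSpace ℂ (Fin n)) 1 ∧ 2 * sparseError s z ≤ l1Norm z}

/-- The complex null space property of order `s`: the infimum of `‖A z‖₂` over `nspSet n s` is
positive. The infimum is taken in `[0, ∞]`, so it is `∞` if that set is empty. -/
def NullSpaceProperty {m n : ℕ} (s : ℕ) (A : Matrix (Fin m) (Fin n) ℂ) : Prop :=
  0 < ⨅ z ∈ nspSet n s, ‖(WithLp.toLp 2 (A.mulVec (fun k => z k)) : EuclideanSpace ℂ (Fin m))‖ₑ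

/-- `E |⟨a, z⟩|² = ‖z‖²` for all `z`. -/
def Isotropic {n : ℕ} {Ω : Type*} [MeasurableSpace Ω] (μ : Measure Ω)
    (a : Ω → EuclideanSpace ℂ (Fin n)) : Prop :=
  ∀ z : EuclideanSpace ℂ (Fin n),
    Integrable (fun ω => ‖inner ℂ (a ω) z‖ ^ 2) μ ∧ ∫ ω, ‖inner ℂ (a ω) z‖ ^ 2 ∂μ = ‖z‖ ^ 2

/-- `max_k |⟨e_k, a⟩|² = 1` almost surely. -/
def Incoherent {n : ℕ} {Ω : Type*} [MeasurableSpace Ω] (μ : Measure Ω)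
    (a : Ω → EuclideanSpace ℂ (Fin n)) : Prop :=
  ∀ᵐ ω ∂μ, IsGreatest
    (Set.range fun k : Fin n => ‖inner ℂ (EuclideanSpace.single k (1 : ℂ)) (a ω)‖ ^ 2) 1

/-- `E |⟨a, z⟩|⁴ ≤ C₄ ‖z‖⁴` for all `z`. -/
def FourthMomentBound {n : ℕ} {Ω : Type*} [MeasurableSpace Ω] (μ : Measure Ω)
    (a : Ω → EuclideanSpace ℂ (Fin n)) (C₄ : ℝ) : Prop :=
  ∀ z : EuclideanSpace ℂ (Fin n),
    Integrable (fun ω => ‖inner ℂ (a ω) z‖ ^ 4) μ ∧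
      ∫ ω, ‖inner ℂ (a ω) z‖ ^ 4 ∂μ ≤ C₄ * ‖z‖ ^ 4

/-- The `m × n` matrix whose `i`-th row is the vector `v i`. -/
def rowMatrix {m n : ℕ} (v : Fin m → EuclideanSpace ℂ (Fin n)) : Matrix (Fin m) (Fin n) ℂ :=
  Matrix.of fun i k => v i k

end CompressedSensing

end

/-! Members of `nspSet n s` are unit vectors with `ℓ₁`-norm at most `2√s`, hence multiples of convex
combinations of the `4n` vectors `Iᶜ • e_j`. Maurey's sampling is applied to the difference `‖B x‖²
- κ‖x‖²` itself: replacing a mean by a random sample changes its average only by a variance term. A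
lower bound on all sums of `64 s + 1` signed basis vectors therefore extends to `nspSet n s` with an
affordable loss (`exists_sample_le`, `lower_bound_of_signedBasis_sums`). Incoherence enters only
through the bound `‖A e_j‖² ≤ m`.

For one fixed sum `x`, `‖A x‖²` is a sum of independent nonnegative terms, so second moments of
these terms, that is fourth moments of `⟨a, x⟩`, already give an exponential lower tail
(`measure_sum_le_half_mean`). A union bound over the `(4n)^(64 s + 1)` sums is absorbed once `m ≥ C
s log n`. -/

namespace CompressedSensing

/-! ### Maurey's empirical method for a difference of quadratic forms -/

section Sampling

variable {E F ι : Type*} [NormedAddCommGroup E] [InnerProductSpace ℂ E]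
  [NormedAddCommGroup F] [InnerProductSpace ℂ F] [Fintype ι]

/-- The variance identity for a finitely supported random vector. -/
lemma sum_mul_norm_add_sq (p : ι → ℝ) (hp : ∑ i, p i = 1) (v : ι → E) (x : E) :
    ∑ i, p i * ‖x + v i‖ ^ 2 =
      ‖x + ∑ i, (p i : ℂ) • v i‖ ^ 2 + ∑ i, p i * ‖v i‖ ^ 2 - ‖∑ i, (p i : ℂ) • v i‖ ^ 2 := by
  have h : RCLike.re (inner ℂ x (∑ i, (p i : ℂ) • v i)) =
      ∑ i, p i * RCLike.re (inner ℂ x (v i)) := by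
    rw [inner_sum, map_sum]
    refine Finset.sum_congr rfl fun i _ => ?_
    rw [inner_smul_right]
    simp
  simp_rw [norm_add_sq (𝕜 := ℂ) x, h, mul_add, Finset.sum_add_distrib, ← Finset.sum_mul, hp,
    Finset.mul_sum]
  have h2 : ∑ i, p i * (2 * RCLike.re (inner ℂ x (v i))) =
      ∑ i, 2 * (p i * RCLike.re (inner ℂ x (v i))) :=
    Finset.sum_congr rfl fun i _ => by ring
  rw [h2]
  ring

/-- A weighted average is at least one of the averaged values. -/
lemma exists_le_of_sum_mul {p : ι → ℝ} (hp0 : ∀ i, 0 ≤ p i) (hp : ∑ i, p i = 1) (g : ι → ℝ) :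
    ∃ i, g i ≤ ∑ j, p j * g j := by
  by_contra! h
  have h1 : ∑ i, p i * (∑ j, p j * g j) = ∑ j, p j * g j := by rw [← Finset.sum_mul, hp, one_mul]
  have h2 : ∀ i, p i * (∑ j, p j * g j) ≤ p i * g i := fun i =>
    mul_le_mul_of_nonneg_left (h i).le (hp0 i)
  -- Both weighted sums equal the average, so every termwise inequality is an equality, which
  -- strictness allows only for zero weights.
  have h3 : ∀ i, p i = 0 := by
    intro i
    have h4 := (Finset.sum_eq_sum_iff_of_le fun i _ => h2 i).1 h1 i (Finset.mem_univ i)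
    by_contra hne
    exact (h i).ne (mul_left_cancel₀ hne h4)
  simp [h3] at hp

/-- Maurey's empirical method for a difference of two squared seminorms: some sum of `k` sampled
vectors does at least as well as the average. -/
lemma exists_sample_le (B : E →ₗ[ℂ] F) (κ : ℝ) {p : ι → ℝ} (hp0 : ∀ i, 0 ≤ p i)
    (hp : ∑ i, p i = 1) (v : ι → E) {w : E} (hw : w = ∑ i, (p i : ℂ) • v i) (k : ℕ) (x : E) :
    ∃ f : Fin k → ι,
      ‖B (x + ∑ j, v (f j))‖ ^ 2 - κ * ‖x + ∑ j, v (f j)‖ ^ 2 ≤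
        ‖B (x + (k : ℂ) • w)‖ ^ 2 - κ * ‖x + (k : ℂ) • w‖ ^ 2 +
          k * (∑ i, p i * (‖B (v i)‖ ^ 2 - κ * ‖v i‖ ^ 2) - (‖B w‖ ^ 2 - κ * ‖w‖ ^ 2)) := by
  induction k generalizing x with
  | zero => exact ⟨Fin.elim0, by simp⟩
  | succ k ih =>
    -- The variance term does not depend on `y`, so the errors of successive replacements simply add
    -- up.
    have key (y : E) : ∑ i, p i * (‖B (y + v i)‖ ^ 2 - κ * ‖y + v i‖ ^ 2) =
        ‖B (y + w)‖ ^ 2 - κ * ‖y + w‖ ^ 2 +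
          (∑ i, p i * (‖B (v i)‖ ^ 2 - κ * ‖v i‖ ^ 2) - (‖B w‖ ^ 2 - κ * ‖w‖ ^ 2)) := by
      have h1 := sum_mul_norm_add_sq p hp v y
      have h2 := sum_mul_norm_add_sq p hp (fun i => B (v i)) (B y)
      have h3 : ∑ i, (p i : ℂ) • B (v i) = B w := by simp [hw]
      rw [h3] at h2
      rw [← hw] at h1
      simp only [map_add, mul_sub, Finset.sum_sub_distrib, mul_left_comm _ κ, ← Finset.mul_sum]
      rw [h1, h2]
      ring
    obtain ⟨u, hu⟩ := exists_le_of_sum_mul hp0 hp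
      fun i => ‖B (x + (k : ℂ) • w + v i)‖ ^ 2 - κ * ‖x + (k : ℂ) • w + v i‖ ^ 2
    rw [key] at hu
    obtain ⟨f, hf⟩ := ih (x + v u)
    refine ⟨Fin.cons u f, ?_⟩
    have e1 : x + ∑ j, v ((Fin.cons u f : Fin (k + 1) → ι) j) = x + v u + ∑ j, v (f j) := by
      rw [Fin.sum_univ_succ]
      simp [add_assoc]
    have e2 : x + v u + (k : ℂ) • w = x + (k : ℂ) • w + v u := by abel
    have e3 : x + ((k + 1 : ℕ) : ℂ) • w = x + (k : ℂ) • w + w := by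
      push_cast
      rw [add_smul, one_smul, add_assoc]
    rw [e1, e3]
    rw [e2] at hf
    push_cast
    linarith

/-- A lower bound for `‖B x‖` on all sums of `k + 1` vectors from a finite family extends to
convex combinations of the family, up to an error of order `1 / k`. -/
lemma lower_bound_of_samples (B : E →ₗ[ℂ] F) {κ M : ℝ} (hκ : 0 ≤ κ) {p : ι → ℝ}
    (hp0 : ∀ i, 0 ≤ p i) (hp : ∑ i, p i = 1) (v : ι → E) {w : E}
    (hw : w = ∑ i, (p i : ℂ) • v i) {k : ℕ} (hM : ∀ i, ‖B (v i)‖ ^ 2 ≤ M)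
    (hf : ∀ f : Fin (k + 1) → ι, κ * ‖∑ j, v (f j)‖ ^ 2 ≤ ‖B (∑ j, v (f j))‖ ^ 2) :
    k * (κ * ‖w‖ ^ 2) - M ≤ k * ‖B w‖ ^ 2 := by
  obtain ⟨f, h⟩ := exists_sample_le B κ hp0 hp v hw (k + 1) 0
  have h1 := hf f
  have h2 : ∑ i, p i * (‖B (v i)‖ ^ 2 - κ * ‖v i‖ ^ 2) ≤ M := by
    calc _ ≤ ∑ i, p i * M := Finset.sum_le_sum fun i _ => by
            refine mul_le_mul_of_nonneg_left ?_ (hp0 i)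
            have := mul_nonneg hκ (sq_nonneg ‖v i‖)
            linarith [hM i]
      _ = M := by rw [← Finset.sum_mul, hp, one_mul]
  have hk : (0 : ℝ) < (k : ℝ) + 1 := by positivity
  have h3 : ‖((k + 1 : ℕ) : ℂ)‖ = (k : ℝ) + 1 := by
    rw [Complex.norm_natCast]
    push_cast
    rfl
  simp only [zero_add, map_smul, norm_smul, h3, mul_pow] at h
  push_cast at h
  -- Write `Q = ‖B w‖² - κ‖w‖²`. With `k + 1` samples the bound reads `(k+1)² Q + (k+1)(M - Q) =
  -- (k+1)(k Q + M)`, so one extra sample absorbs the `-Q`.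
  have h4 : 0 ≤ ((k : ℝ) + 1) * (k * (‖B w‖ ^ 2 - κ * ‖w‖ ^ 2) + M) := by
    have := mul_le_mul_of_nonneg_left h2 hk.le
    linarith
  have := nonneg_of_mul_nonneg_right h4 hk
  linarith

end Sampling

/-! ### Exponential lower tails from second moments -/

section LowerTail

/-- The product `(1 - t + t²)(1 + t + t²/2)` equals `1 + (t² + t³ + t⁴)/2 ≥ 1`. -/
lemma exp_neg_le_one_sub_add_sq {t : ℝ} (ht : 0 ≤ t) : Real.exp (-t) ≤ 1 - t + t ^ 2 := by
  rw [Real.exp_neg, inv_le_iff_one_le_mul₀ (Real.exp_pos t)]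
  have h := Real.quadratic_le_exp_of_nonneg ht
  have h0 : 0 ≤ 1 - t + t ^ 2 := by nlinarith [sq_nonneg (t - 1)]
  refine le_trans ?_ (mul_le_mul_of_nonneg_left h h0)
  have h3 : 0 ≤ t ^ 3 := by positivity
  nlinarith [sq_nonneg t, sq_nonneg (t ^ 2)]

variable {Ω : Type*} [MeasurableSpace Ω] {μ : Measure Ω} [IsProbabilityMeasure μ]

/-- Since `X ≥ 0`, the quadratic bound on `exp (-t X)` holds pointwise, so two moments suffice and
no tail assumption is needed. -/
lemma mgf_neg_le {X : Ω → ℝ} {σ K t : ℝ} (hX0 : ∀ ω, 0 ≤ X ω) (ht : 0 ≤ t)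
    (hX : Integrable X μ) (hX2 : Integrable (fun ω => X ω ^ 2) μ) (h1 : ∫ ω, X ω ∂μ = σ)
    (h2 : ∫ ω, X ω ^ 2 ∂μ ≤ K * σ ^ 2) :
    mgf X μ (-t) ≤ Real.exp (-(t * σ) + t ^ 2 * (K * σ ^ 2)) := by
  have hlin : Integrable (fun ω => 1 - t * X ω) μ := (integrable_const _).sub (hX.const_mul t)
  have hint : Integrable (fun ω => 1 - t * X ω + t ^ 2 * X ω ^ 2) μ := hlin.add (hX2.const_mul _)
  have hle : mgf X μ (-t) ≤ ∫ ω, (1 - t * X ω + t ^ 2 * X ω ^ 2) ∂μ := by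
    refine integral_mono_of_nonneg (.of_forall fun ω => (Real.exp_pos _).le) hint
      (.of_forall fun ω => ?_)
    have := exp_neg_le_one_sub_add_sq (mul_nonneg ht (hX0 ω))
    simp only [neg_mul]
    linarith [mul_pow t (X ω) 2]
  have heq : ∫ ω, (1 - t * X ω + t ^ 2 * X ω ^ 2) ∂μ = 1 - t * σ + t ^ 2 * ∫ ω, X ω ^ 2 ∂μ := by
    rw [integral_add hlin (hX2.const_mul _),
      integral_sub (integrable_const _) (hX.const_mul t), integral_const_mul, integral_const_mul,
      h1]
    simp
  have := mul_le_mul_of_nonneg_left h2 (sq_nonneg t)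
  have := Real.add_one_le_exp (-(t * σ) + t ^ 2 * (K * σ ^ 2))
  linarith

/-- Sums of independent nonnegative variables with controlled second moments have an exponential
lower tail. -/
lemma measure_sum_le_half_mean {m : ℕ} {X : Fin m → Ω → ℝ} {σ K : ℝ} (hσ : 0 < σ) (hK : 0 < K)
    (hX0 : ∀ i ω, 0 ≤ X i ω) (hindep : iIndepFun X μ)
    (hX : ∀ i, Integrable (X i) μ) (hX2 : ∀ i, Integrable (fun ω => X i ω ^ 2) μ)
    (h1 : ∀ i, ∫ ω, X i ω ∂μ = σ) (h2 : ∀ i, ∫ ω, X i ω ^ 2 ∂μ ≤ K * σ ^ 2) :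
    μ.real {ω | ∑ i, X i ω ≤ m / 2 * σ} ≤ Real.exp (-(m / (16 * K))) := by
  -- This minimizes the Chernoff exponent `m (-tσ/2 + t² K σ²)`, with value `-m / (16 K)`.
  set t : ℝ := 1 / (4 * K * σ) with ht
  have ht0 : 0 ≤ t := by positivity
  have hae : ∀ i, AEMeasurable (X i) μ := fun i => (hX i).aemeasurable
  have hint : Integrable (fun ω => Real.exp (-t * (∑ i, X i) ω)) μ := by
    refine Integrable.of_bound (C := 1) ?_ (.of_forall fun ω => ?_)
    · have : AEMeasurable (∑ i, X i) μ := Finset.aemeasurable_sum _ fun i _ => hae i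
      exact (Real.measurable_exp.comp_aemeasurable (this.const_mul (-t))).aestronglyMeasurable
    · rw [Real.norm_eq_abs, Real.abs_exp, Real.exp_le_one_iff, Finset.sum_apply]
      have := mul_nonneg ht0 (Finset.sum_nonneg fun i (_ : i ∈ Finset.univ) => hX0 i ω)
      linarith
  have h := measure_le_le_exp_mul_mgf (X := ∑ i, X i) (m / 2 * σ) (neg_nonpos.2 ht0) hint
  rw [hindep.mgf_sum₀ hae] at h
  simp only [Finset.sum_apply] at h
  refine h.trans ?_
  have hprod : ∏ i, mgf (X i) μ (-t) ≤ Real.exp (-(t * σ) + t ^ 2 * (K * σ ^ 2)) ^ m := by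
    calc _ ≤ ∏ _i : Fin m, Real.exp (-(t * σ) + t ^ 2 * (K * σ ^ 2)) :=
          Finset.prod_le_prod (fun i _ => mgf_nonneg) fun i _ =>
            mgf_neg_le (hX0 i) ht0 (hX i) (hX2 i) (h1 i) (h2 i)
      _ = _ := by simp
  refine (mul_le_mul_of_nonneg_left hprod (Real.exp_pos _).le).trans (le_of_eq ?_)
  rw [← Real.exp_nat_mul, ← Real.exp_add]
  congr 1
  rw [ht]
  field_simp
  ring

end LowerTail

/-! ### Signed basis vectors and reduction of the null space property to finitely many sums -/

section Vectors

variable {n : ℕ}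

/-- The vectors `Iᶜ • e_j`, for `c = 0, 1, 2, 3`. -/
noncomputable def signedBasis (u : Fin n × Fin 4) : EuclideanSpace ℂ (Fin n) :=
  EuclideanSpace.single u.1 (Complex.I ^ (u.2 : ℕ))

/-- The coefficients of a complex number with respect to `1, I, -1, -I`. -/
noncomputable def phaseCoeff (z : ℂ) : Fin 4 → ℝ :=
  ![max z.re 0, max z.im 0, max (-z.re) 0, max (-z.im) 0]

lemma phaseCoeff_nonneg (z : ℂ) (c : Fin 4) : 0 ≤ phaseCoeff z c := by
  fin_cases c <;> simp [phaseCoeff]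

lemma max_zero_add_max_neg_zero (a : ℝ) : max a 0 + max (-a) 0 = |a| := by
  rcases le_total 0 a with h | h
  · rw [max_eq_left h, max_eq_right (by linarith), abs_of_nonneg h, add_zero]
  · rw [max_eq_right h, max_eq_left (by linarith), abs_of_nonpos h, zero_add]

lemma max_zero_sub_max_neg_zero (a : ℝ) : max a 0 - max (-a) 0 = a := by
  rcases le_total 0 a with h | h
  · rw [max_eq_left h, max_eq_right (by linarith), sub_zero]
  · rw [max_eq_right h, max_eq_left (by linarith), zero_sub, neg_neg]

lemma sum_phaseCoeff (z : ℂ) : ∑ c, phaseCoeff z c = |z.re| + |z.im| := by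
  rw [← max_zero_add_max_neg_zero, ← max_zero_add_max_neg_zero, Fin.sum_univ_four]
  simp only [phaseCoeff, Matrix.cons_val]
  ring

lemma sum_phaseCoeff_mul (z : ℂ) : ∑ c, (phaseCoeff z c : ℂ) * Complex.I ^ (c : ℕ) = z := by
  have h1 := max_zero_sub_max_neg_zero z.re
  have h2 := max_zero_sub_max_neg_zero z.im
  rw [Fin.sum_univ_four]
  simp only [phaseCoeff, Matrix.cons_val, Fin.val_zero, Fin.val_one, Fin.val_two,
    show ((3 : Fin 4) : ℕ) = 3 from rfl, pow_zero, pow_one, Complex.I_sq, Complex.I_pow_three]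
  apply Complex.ext <;> simp <;> linarith

lemma sum_phaseCoeff_smul_signedBasis (z : EuclideanSpace ℂ (Fin n)) :
    ∑ u : Fin n × Fin 4, (phaseCoeff (z u.1) u.2 : ℂ) • signedBasis u = z := by
  ext j
  rw [Fintype.sum_prod_type, WithLp.ofLp_sum, Finset.sum_apply, Finset.sum_eq_single j]
  · simp only [signedBasis, WithLp.ofLp_sum, Finset.sum_apply]
    simpa using sum_phaseCoeff_mul (z j)
  · intro b _ hb
    simp [signedBasis, WithLp.ofLp_sum, Finset.sum_apply, hb.symm]
  · simp

lemma sum_phaseCoeff_le (z : EuclideanSpace ℂ (Fin n)) :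
    ∑ u : Fin n × Fin 4, phaseCoeff (z u.1) u.2 ≤ 2 * l1Norm z := by
  rw [Fintype.sum_prod_type, l1Norm, Finset.mul_sum]
  refine Finset.sum_le_sum fun j _ => ?_
  refine (sum_phaseCoeff (z j)).le.trans ?_
  linarith [Complex.abs_re_le_norm (z j), Complex.abs_im_le_norm (z j)]

/-- A lower bound on sums of `k + 1` signed basis vectors extends to all vectors, up to an error
governed by the `ℓ₁`-norm. -/
lemma lower_bound_of_signedBasis_sums {F : Type*} [NormedAddCommGroup F] [InnerProductSpace ℂ F]
    (B : EuclideanSpace ℂ (Fin n) →ₗ[ℂ] F) {κ M : ℝ} (hκ : 0 ≤ κ) {k : ℕ}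
    (hM : ∀ u, ‖B (signedBasis u)‖ ^ 2 ≤ M)
    (hf : ∀ f : Fin (k + 1) → Fin n × Fin 4,
      κ * ‖∑ j, signedBasis (f j)‖ ^ 2 ≤ ‖B (∑ j, signedBasis (f j))‖ ^ 2)
    {z : EuclideanSpace ℂ (Fin n)} (hz : z ≠ 0) :
    k * (κ * ‖z‖ ^ 2) - M * (2 * l1Norm z) ^ 2 ≤ k * ‖B z‖ ^ 2 := by
  set L := ∑ u : Fin n × Fin 4, phaseCoeff (z u.1) u.2 with hL
  have hL0 : 0 ≤ L := Finset.sum_nonneg fun u _ => phaseCoeff_nonneg _ _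
  have hLpos : 0 < L := by
    refine lt_of_le_of_ne hL0 fun h => hz ?_
    have h0 := (Finset.sum_eq_zero_iff_of_nonneg fun u _ => phaseCoeff_nonneg _ _).1 h.symm
    rw [← sum_phaseCoeff_smul_signedBasis z]
    exact Finset.sum_eq_zero fun u hu => by simp [h0 u hu]
  have hLC : (L : ℂ) ≠ 0 := by exact_mod_cast hLpos.ne'
  obtain ⟨u₀⟩ : Nonempty (Fin n × Fin 4) := by
    by_contra h
    rw [not_nonempty_iff] at h
    simp [hL] at hLpos
  have hM0 : 0 ≤ M := (sq_nonneg _).trans (hM u₀)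
  -- Dividing by the total weight `L` makes `z / L` a convex combination; multiplying by `L²` below
  -- undoes the scaling.
  have h := lower_bound_of_samples B hκ (p := fun u => phaseCoeff (z u.1) u.2 / L)
    (fun u => div_nonneg (phaseCoeff_nonneg _ _) hL0)
    (by rw [← Finset.sum_div, div_self hLpos.ne']) signedBasis
    (w := (L : ℂ)⁻¹ • z) (by
      conv_lhs => rw [← sum_phaseCoeff_smul_signedBasis z]
      rw [Finset.smul_sum]
      refine Finset.sum_congr rfl fun u _ => ?_
      rw [smul_smul]
      push_cast
      rw [div_eq_inv_mul]) hM hf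
  have hn : ‖(L : ℂ)⁻¹‖ = L⁻¹ := by
    rw [norm_inv, Complex.norm_real, Real.norm_of_nonneg hL0]
  rw [map_smul, norm_smul, norm_smul, hn] at h
  have h2 := mul_le_mul_of_nonneg_left h (sq_nonneg L)
  have e1 : L ^ 2 * (k * (κ * (L⁻¹ * ‖z‖) ^ 2) - M) = k * (κ * ‖z‖ ^ 2) - M * L ^ 2 := by
    field_simp
  have e2 : L ^ 2 * (k * (L⁻¹ * ‖B z‖) ^ 2) = k * ‖B z‖ ^ 2 := by
    field_simp
  rw [e1, e2] at h2
  have h3 : M * L ^ 2 ≤ M * (2 * l1Norm z) ^ 2 :=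
    mul_le_mul_of_nonneg_left (pow_le_pow_left₀ hL0 (sum_phaseCoeff_le z) 2) hM0
  linarith

lemma l1Norm_nonneg (z : EuclideanSpace ℂ (Fin n)) : 0 ≤ l1Norm z :=
  Finset.sum_nonneg fun _ _ => norm_nonneg _

/-- The `ℓ₁`-norm is at most `√s` times the `ℓ₂`-norm plus the `ℓ₁`-error of any `s`-sparse
approximation. -/
lemma l1Norm_le_of_zeroNorm_le {s : ℕ} (z w : EuclideanSpace ℂ (Fin n)) (hw : zeroNorm w ≤ s) :
    l1Norm z ≤ Real.sqrt s * ‖z‖ + l1Norm (z - w) := by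
  classical
  set S : Finset (Fin n) := Finset.univ.filter fun k => w k ≠ 0 with hS
  have hcard : S.card ≤ s := hw
  have h1 : ∑ k ∈ S, ‖z k‖ ≤ Real.sqrt s * ‖z‖ := by
    rw [EuclideanSpace.norm_eq, ← Real.sqrt_mul (Nat.cast_nonneg s)]
    refine Real.le_sqrt_of_sq_le ?_
    refine (sq_sum_le_card_mul_sum_sq (s := S) (f := fun k => ‖z k‖)).trans ?_
    have hle : ∑ k ∈ S, ‖z k‖ ^ 2 ≤ ∑ k, ‖z k‖ ^ 2 :=
      Finset.sum_le_sum_of_subset_of_nonneg (Finset.subset_univ S) fun _ _ _ => sq_nonneg _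
    have hc : (S.card : ℝ) ≤ s := by exact_mod_cast hcard
    exact mul_le_mul hc hle (Finset.sum_nonneg fun _ _ => sq_nonneg _) (Nat.cast_nonneg s)
  have h2 : ∑ k ∈ Sᶜ, ‖z k‖ ≤ l1Norm (z - w) := by
    calc ∑ k ∈ Sᶜ, ‖z k‖ = ∑ k ∈ Sᶜ, ‖(z - w) k‖ := Finset.sum_congr rfl fun k hk => by
            have : w k = 0 := by simpa [hS] using hk
            simp [this]
      _ ≤ _ := Finset.sum_le_sum_of_subset_of_nonneg (Finset.subset_univ _)
            fun _ _ _ => norm_nonneg _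
  have h3 : l1Norm z = ∑ k ∈ S, ‖z k‖ + ∑ k ∈ Sᶜ, ‖z k‖ := (Finset.sum_add_sum_compl S _).symm
  linarith

/-- On the unit sphere `σ_s(z) ≥ ‖z‖₁ - √s`; combine with `2 σ_s(z) ≤ ‖z‖₁`. -/
lemma l1Norm_le_of_mem_nspSet {s : ℕ} {z : EuclideanSpace ℂ (Fin n)} (hz : z ∈ nspSet n s) :
    l1Norm z ≤ 2 * Real.sqrt s := by
  obtain ⟨hz1, hz2⟩ := hz
  rw [mem_sphere_zero_iff_norm] at hz1
  have : Nonempty {z : EuclideanSpace ℂ (Fin n) // zeroNorm z ≤ s} :=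
    ⟨⟨0, by simp [zeroNorm, hammingNorm]⟩⟩
  have h : l1Norm z - Real.sqrt s ≤ sparseError s z := by
    refine le_ciInf fun w => ?_
    have := l1Norm_le_of_zeroNorm_le z w.1 w.2
    rw [hz1] at this
    linarith
  linarith

/-- The null space property follows from a uniform lower bound. -/
lemma nullSpaceProperty_of_le {m s : ℕ} {A : Matrix (Fin m) (Fin n) ℂ} {ε : ℝ} (hε : 0 < ε)
    (h : ∀ z ∈ nspSet n s, ε ≤ ‖Matrix.toEuclideanLin A z‖ ^ 2) : NullSpaceProperty s A := by
  refine lt_of_lt_of_le (ENNReal.ofReal_pos.2 (Real.sqrt_pos.2 hε)) (le_iInf₂ fun z hz => ?_)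
  rw [← ofReal_norm]
  refine ENNReal.ofReal_le_ofReal ?_
  exact (Real.sqrt_le_left (norm_nonneg _)).2 (h z hz)

/-- The null space property of order `s ≥ 1` follows from a lower bound on the sums of `64 s + 1`
signed basis vectors. -/
lemma nullSpaceProperty_of_signedBasis_sums {m s : ℕ} (hm : 0 < m) (hs : 0 < s)
    {A : Matrix (Fin m) (Fin n) ℂ} (hA : ∀ i j, ‖A i j‖ ≤ 1)
    (hf : ∀ f : Fin (64 * s + 1) → Fin n × Fin 4,
      m / 2 * ‖∑ j, signedBasis (f j)‖ ^ 2 ≤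
        ‖Matrix.toEuclideanLin A (∑ j, signedBasis (f j))‖ ^ 2) :
    NullSpaceProperty s A := by
  have hm' : (0 : ℝ) < m := by exact_mod_cast hm
  have hs' : (0 : ℝ) < s := by exact_mod_cast hs
  -- With `κ = m/2`, `M = m`, `k = 64 s` and `(2‖z‖₁)² ≤ 16 s`, the bound is `32 s m - 16 s m = 64 s
  -- · m/4`.
  refine nullSpaceProperty_of_le (ε := m / 4) (by positivity) fun z hz => ?_
  have hM : ∀ u, ‖Matrix.toEuclideanLin A (signedBasis u)‖ ^ 2 ≤ m := by
    intro u
    rw [EuclideanSpace.norm_sq_eq]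
    calc _ ≤ ∑ _i : Fin m, (1 : ℝ) := Finset.sum_le_sum fun i _ => by
            refine pow_le_one₀ (norm_nonneg _) ?_
            simpa [signedBasis, Matrix.ofLp_toLpLin, Matrix.toLin'_apply,
              Matrix.mulVec_single] using hA i u.1
      _ = m := by simp
  have hz1 : ‖z‖ = 1 := mem_sphere_zero_iff_norm.1 hz.1
  have h := lower_bound_of_signedBasis_sums (Matrix.toEuclideanLin A) (by positivity) hM hf
    (z := z) (norm_ne_zero_iff.1 (by rw [hz1]; exact one_ne_zero))
  have hl : (2 * l1Norm z) ^ 2 ≤ 16 * s := by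
    have h2 := l1Norm_le_of_mem_nspSet hz
    have h3 := pow_le_pow_left₀ (l1Norm_nonneg z) h2 2
    rw [mul_pow, Real.sq_sqrt hs'.le] at h3
    linarith
  rw [hz1] at h
  push_cast at h
  have h4 := mul_le_mul_of_nonneg_left hl hm'.le
  have h5 : 0 < 64 * (s : ℝ) := by positivity
  refine le_of_mul_le_mul_left ?_ h5
  linarith

/-- `nspSet n 0` is empty: its members would be unit vectors with zero `ℓ₁`-norm. -/
lemma nullSpaceProperty_zero {m : ℕ} (A : Matrix (Fin m) (Fin n) ℂ) : NullSpaceProperty 0 A := by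
  refine nullSpaceProperty_of_le one_pos fun z hz => ?_
  have h1 := l1Norm_le_of_mem_nspSet hz
  have hz1 : ‖z‖ = 1 := mem_sphere_zero_iff_norm.1 hz.1
  have h0 : l1Norm z = 0 := le_antisymm (by simpa using h1) (l1Norm_nonneg z)
  have : z = 0 := by
    ext k
    have := (Finset.sum_eq_zero_iff_of_nonneg fun k _ => norm_nonneg (z k)).1 h0 k
      (Finset.mem_univ k)
    simpa using this
  simp [this] at hz1

end Vectors

/-! ### Random rows and the union bound -/

section Random

variable {n m : ℕ} {Ω₀ Ω : Type*} [MeasurableSpace Ω₀] [MeasurableSpace Ω]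
  {μ₀ : Measure Ω₀} {μ : Measure Ω} {a : Ω₀ → EuclideanSpace ℂ (Fin n)}
  {A : Fin m → Ω → EuclideanSpace ℂ (Fin n)}

/-- The coordinatewise complex conjugate. -/
noncomputable def conjVec (x : EuclideanSpace ℂ (Fin n)) : EuclideanSpace ℂ (Fin n) :=
  WithLp.toLp 2 fun k => star (x k)

lemma norm_conjVec (x : EuclideanSpace ℂ (Fin n)) : ‖conjVec x‖ = ‖x‖ := by
  simp [EuclideanSpace.norm_eq, conjVec]

/-- The rows are unconjugated while the inner product conjugates its first argument. Moving the
conjugation to `x` is harmless, as the moment hypotheses cover all vectors. -/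
lemma norm_sq_toEuclideanLin_rowMatrix (v : Fin m → EuclideanSpace ℂ (Fin n))
    (x : EuclideanSpace ℂ (Fin n)) :
    ‖Matrix.toEuclideanLin (rowMatrix v) x‖ ^ 2 = ∑ i, ‖inner ℂ (v i) (conjVec x)‖ ^ 2 := by
  rw [EuclideanSpace.norm_sq_eq]
  refine Finset.sum_congr rfl fun i _ => ?_
  have h : inner ℂ (v i) (conjVec x) = star (Matrix.toEuclideanLin (rowMatrix v) x i) := by
    simp [Matrix.mulVec, dotProduct, rowMatrix, conjVec,
      PiLp.inner_apply, mul_comm]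
  rw [h, norm_star]

lemma Incoherent.ae_norm_le [IsProbabilityMeasure μ₀] (hinc : Incoherent μ₀ a)
    {B : Ω → EuclideanSpace ℂ (Fin n)} (hB : IdentDistrib B a μ μ₀) :
    ∀ᵐ ω ∂μ, IsGreatest (Set.range fun k : Fin n => ‖B ω k‖ ^ 2) 1 := by
  have hmeas : MeasurableSet {v : EuclideanSpace ℂ (Fin n) |
      IsGreatest (Set.range fun k : Fin n => ‖v k‖ ^ 2) 1} := by
    simp only [IsGreatest, upperBounds, Set.mem_range, Set.mem_ofPred_eq]
    measurability
  refine hB.symm.ae_snd hmeas ?_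
  filter_upwards [hinc] with ω hω
  simpa [EuclideanSpace.inner_single_left] using hω

/-- The exponential lower tail of `‖A x‖²` for a fixed vector `x`. -/
lemma measure_norm_sq_lt_half [IsProbabilityMeasure μ] {C₄ : ℝ} (hC₄ : 0 < C₄)
    (hiso : Isotropic μ₀ a) (h4 : FourthMomentBound μ₀ a C₄) (hindep : iIndepFun A μ)
    (hid : ∀ i, IdentDistrib (A i) a μ μ₀) (x : EuclideanSpace ℂ (Fin n)) :
    μ.real {ω | ‖Matrix.toEuclideanLin (rowMatrix fun i => A i ω) x‖ ^ 2 < m / 2 * ‖x‖ ^ 2} ≤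
      Real.exp (-(m / (16 * C₄))) := by
  -- The tail bound needs a positive mean; for `x = 0` the strict inequality makes the event empty.
  rcases eq_or_ne x 0 with rfl | hx
  · simpa using (Real.exp_pos _).le
  have hg : Measurable fun v : EuclideanSpace ℂ (Fin n) => ‖inner ℂ v (conjVec x)‖ ^ 2 :=
    Continuous.measurable (by fun_prop)
  have hXid : ∀ i, IdentDistrib (fun ω => ‖inner ℂ (A i ω) (conjVec x)‖ ^ 2)
      (fun ω => ‖inner ℂ (a ω) (conjVec x)‖ ^ 2) μ μ₀ := fun i => (hid i).comp hg
  have hX2id : ∀ i, IdentDistrib (fun ω => (‖inner ℂ (A i ω) (conjVec x)‖ ^ 2) ^ 2)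
      (fun ω => (‖inner ℂ (a ω) (conjVec x)‖ ^ 2) ^ 2) μ μ₀ := fun i => (hXid i).sq
  obtain ⟨hi, he⟩ := hiso (conjVec x)
  obtain ⟨hi4, he4⟩ := h4 (conjVec x)
  have hpow : (fun ω => (‖inner ℂ (a ω) (conjVec x)‖ ^ 2) ^ 2) =
      fun ω => ‖inner ℂ (a ω) (conjVec x)‖ ^ 4 := by
    funext ω
    ring
  have h := measure_sum_le_half_mean (μ := μ) (σ := ‖x‖ ^ 2) (K := C₄)
    (X := fun i ω => ‖inner ℂ (A i ω) (conjVec x)‖ ^ 2)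
    (by positivity) hC₄ (fun i ω => sq_nonneg _) (hindep.comp _ fun _ => hg)
    (fun i => (hXid i).integrable_iff.2 hi)
    (fun i => (hX2id i).integrable_iff.2 (by rw [hpow]; exact hi4))
    (fun i => by rw [(hXid i).integral_eq, he, norm_conjVec])
    (fun i => by
      rw [(hX2id i).integral_eq, hpow]
      refine he4.trans (le_of_eq ?_)
      rw [norm_conjVec]
      ring)
  refine (measureReal_mono fun ω hω => ?_).trans h
  rw [Set.mem_ofPred_eq, norm_sq_toEuclideanLin_rowMatrix] at hω
  exact hω.le

/-- The null space property fails with probability at most `(4 n) ^ (64 s + 1) * exp (-c m)`. -/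
lemma measure_not_nullSpaceProperty_le [IsProbabilityMeasure μ₀] [IsProbabilityMeasure μ]
    {C₄ : ℝ} (hC₄ : 0 < C₄) {s : ℕ} (hm : 0 < m) (hs : 0 < s)
    (hiso : Isotropic μ₀ a) (hinc : Incoherent μ₀ a) (h4 : FourthMomentBound μ₀ a C₄)
    (hindep : iIndepFun A μ) (hid : ∀ i, IdentDistrib (A i) a μ μ₀) :
    μ.real {ω | NullSpaceProperty s (rowMatrix fun i => A i ω)}ᶜ ≤
      (4 * n : ℝ) ^ (64 * s + 1) * Real.exp (-(m / (16 * C₄))) := by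
  set bad : (Fin (64 * s + 1) → Fin n × Fin 4) → Set Ω := fun f =>
    {ω | ‖Matrix.toEuclideanLin (rowMatrix fun i => A i ω) (∑ j, signedBasis (f j))‖ ^ 2 <
      m / 2 * ‖∑ j, signedBasis (f j)‖ ^ 2} with hbad
  have hentry : ∀ᵐ ω ∂μ, ∀ i k, ‖A i ω k‖ ≤ 1 := by
    refine ae_all_iff.2 fun i => ?_
    filter_upwards [hinc.ae_norm_le (hid i)] with ω hω k
    exact (sq_le_one_iff₀ (norm_nonneg _)).1 (hω.2 ⟨k, rfl⟩)
  -- The inclusion is only almost sure because the entry bound is.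
  have hsub : ({ω | NullSpaceProperty s (rowMatrix fun i => A i ω)}ᶜ : Set Ω) ≤ᵐ[μ]
      ⋃ f, bad f := by
    filter_upwards [hentry] with ω hω hnot
    by_contra hall
    refine hnot (nullSpaceProperty_of_signedBasis_sums hm hs hω fun f => ?_)
    by_contra hf
    exact hall (Set.mem_iUnion.2 ⟨f, not_le.1 hf⟩)
  calc _ ≤ μ.real (⋃ f, bad f) :=
        ENNReal.toReal_mono (measure_ne_top _ _) (measure_mono_ae hsub)
    _ ≤ ∑ f, μ.real (bad f) := measureReal_iUnion_fintype_le _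
    _ ≤ ∑ _f : Fin (64 * s + 1) → Fin n × Fin 4, Real.exp (-(m / (16 * C₄))) :=
        Finset.sum_le_sum fun f _ => measure_norm_sq_lt_half hC₄ hiso h4 hindep hid _
    _ = _ := by simp [mul_comm]

/-- A probability bound on the complement gives one on the set, measurable or not. -/
lemma one_sub_le_measureReal [IsProbabilityMeasure μ] {S : Set Ω} {ε : ℝ}
    (h : μ.real Sᶜ ≤ ε) : 1 - ε ≤ μ.real S := by
  have h1 := measureReal_union_le (μ := μ) S Sᶜ
  rw [Set.union_compl_self, probReal_univ] at h1
  linarith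

/-- In dimension one, an incoherent measurement is almost surely injective. -/
lemma measure_nullSpaceProperty_dim_one [IsProbabilityMeasure μ₀] [IsProbabilityMeasure μ]
    {a : Ω₀ → EuclideanSpace ℂ (Fin 1)} {A : Fin m → Ω → EuclideanSpace ℂ (Fin 1)} {s : ℕ}
    (hm : 0 < m) (hinc : Incoherent μ₀ a) (hid : ∀ i, IdentDistrib (A i) a μ μ₀) :
    μ.real {ω | NullSpaceProperty s (rowMatrix fun i => A i ω)}ᶜ = 0 := by
  rw [measureReal_eq_zero_iff]
  change ∀ᵐ ω ∂μ, NullSpaceProperty s (rowMatrix fun i => A i ω)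
  filter_upwards [hinc.ae_norm_le (hid ⟨0, hm⟩)] with ω hω
  refine nullSpaceProperty_of_le one_pos fun z hz => ?_
  have hz1 : ‖z‖ ^ 2 = 1 := by rw [mem_sphere_zero_iff_norm.1 hz.1, one_pow]
  obtain ⟨k, hk⟩ := hω.1
  obtain rfl := Subsingleton.elim k 0
  rw [EuclideanSpace.norm_sq_eq, Fin.sum_univ_one] at hz1
  rw [EuclideanSpace.norm_sq_eq]
  refine le_trans (le_of_eq ?_) (Finset.single_le_sum (fun i _ => sq_nonneg _)
    (Finset.mem_univ (⟨0, hm⟩ : Fin m)))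
  simp only [Matrix.ofLp_toLpLin, Matrix.toLin'_apply, Matrix.mulVec, dotProduct, rowMatrix,
    Matrix.of_apply, Fin.sum_univ_one, norm_mul, mul_pow]
  rw [hz1, mul_one]
  exact hk.symm

end Random

/-! ### Constants and conclusion -/

/-- The cardinality of the net is absorbed by the exponential tail. -/
lemma net_card_mul_exp_le {n s m : ℕ} (hn : 2 ≤ n) (hs : 0 < s) {K : ℝ} (hK : 0 < K)
    (h : 6240 * K * s * Real.log n ≤ m) :
    (4 * n : ℝ) ^ (64 * s + 1) * Real.exp (-(m / (16 * K))) ≤ Real.exp (-(1 / (32 * K) * m)) := by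
  have hn' : (2 : ℝ) ≤ n := by exact_mod_cast hn
  have hs' : (1 : ℝ) ≤ s := by exact_mod_cast hs
  have hlog : 0 ≤ Real.log n := Real.log_nonneg (by linarith)
  -- `4n ≤ n³` because `n ≥ 2`.
  have h1 : (4 * n : ℝ) ≤ Real.exp (3 * Real.log n) := by
    have e : Real.exp (3 * Real.log n) = (n : ℝ) ^ 3 := by
      rw [mul_comm, Real.exp_mul, Real.exp_log (by linarith)]
      norm_cast
    rw [e]
    nlinarith [mul_le_mul hn' hn' (by norm_num) (by linarith)]
  have h2 := pow_le_pow_left₀ (by positivity) h1 (64 * s + 1)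
  refine (mul_le_mul_of_nonneg_right h2 (Real.exp_pos _).le).trans ?_
  rw [← Real.exp_nat_mul, ← Real.exp_add, Real.exp_le_exp]
  -- Here `195 = 3 · 65` and `6240 = 32 · 195`: the net uses up half of the exponent `m / (16 K)`.
  have h3 : ((64 * s + 1 : ℕ) : ℝ) * (3 * Real.log n) ≤ 195 * (s * Real.log n) := by
    push_cast
    nlinarith
  have h4 : 195 * (s * Real.log n) ≤ m / (32 * K) := by
    rw [le_div_iff₀ (by positivity)]
    linarith
  have h5 : (m : ℝ) / (16 * K) = 2 * (m / (32 * K)) := by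
    field_simp
    norm_num [mul_assoc]
  have h6 : 1 / (32 * K) * (m : ℝ) = m / (32 * K) := by ring
  linarith

end CompressedSensing

theorem theorem5 (C₄ : ℝ) (hC₄ : 0 < C₄) :
    ∃ C : ℝ, 0 < C ∧ ∃ c : ℝ, 0 < c ∧
      ∀ (n s m : ℕ), C * s * Real.log n ≤ m →
      ∀ {Ω₀ : Type*} [MeasurableSpace Ω₀] (μ₀ : Measure Ω₀) [IsProbabilityMeasure μ₀]
        (a : Ω₀ → EuclideanSpace ℂ (Fin n)),
        AEMeasurable a μ₀ →
        CompressedSensing.Isotropic μ₀ a →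
        CompressedSensing.Incoherent μ₀ a →
        CompressedSensing.FourthMomentBound μ₀ a C₄ →
      ∀ {Ω : Type*} [MeasurableSpace Ω] (μ : Measure Ω) [IsProbabilityMeasure μ]
        (A : Fin m → Ω → EuclideanSpace ℂ (Fin n)),
        iIndepFun A μ →
        (∀ i, IdentDistrib (A i) a μ μ₀) →
        1 - 2 * Real.exp (-(c * m)) ≤
          μ.real {ω | CompressedSensing.NullSpaceProperty s
            (CompressedSensing.rowMatrix fun i => A i ω)} := by
  refine ⟨6240 * C₄, by positivity, 1 / (32 * C₄), by positivity, ?_⟩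
  intro n s m hm Ω₀ _ μ₀ _ a _ hiso hinc h4 Ω _ μ _ A hindep hid
  have hexp := Real.exp_pos (-(1 / (32 * C₄) * (m : ℝ)))
  rcases Nat.eq_zero_or_pos s with rfl | hs
  · refine CompressedSensing.one_sub_le_measureReal ?_
    have hall : {ω | CompressedSensing.NullSpaceProperty 0
        (CompressedSensing.rowMatrix fun i => A i ω)} = Set.univ :=
      Set.eq_univ_of_forall fun ω => CompressedSensing.nullSpaceProperty_zero _
    rw [hall, Set.compl_univ, measureReal_empty]
    positivity
  rcases Nat.eq_zero_or_pos m with rfl | hmpos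
  · simp only [Nat.cast_zero, mul_zero, neg_zero, Real.exp_zero]
    linarith [measureReal_nonneg (μ := μ) (s := {ω | CompressedSensing.NullSpaceProperty s
      (CompressedSensing.rowMatrix fun i => A i ω)})]
  refine CompressedSensing.one_sub_le_measureReal ?_
  -- For `n = 0` incoherence is impossible. For `n = 1`, `log n = 0` leaves `m` unconstrained, so
  -- the union bound is not available.
  obtain rfl | rfl | hn : n = 0 ∨ n = 1 ∨ 2 ≤ n := by omega
  · obtain ⟨ω, hω⟩ := hinc.exists
    obtain ⟨k, -⟩ := hω.1
    exact k.elim0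
  · rw [CompressedSensing.measure_nullSpaceProperty_dim_one hmpos hinc hid]
    positivity
  · refine (CompressedSensing.measure_not_nullSpaceProperty_le hC₄ hmpos hs hiso hinc h4
      hindep hid).trans ?_
    linarith [CompressedSensing.net_card_mul_exp_le hn hs hC₄ hm]
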